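/- Let $G$ be a finite group. For $a,b\in G$ write $[a,b]=a^{-1}b^{-1}ab$, and let $|a|$ denote the order of $a$. The $\gamma^*_k$-commutators of $G$ ($k\ge 1$) are defined inductively: every element of $G$ is a $\gamma^*_1$-commutator, and for $k\ge 2$ an element $g\in G$ is a $\gamma^*_k$-commutator if $g=[a,b]$ for some power $a$ of a $\gamma^*_{k-1}$-commutator and some $b\in G$ with $\gcd(|a|,|b|)=1$. Let $\gamma^*_k(G)$ be the subgroup of $G$ generated by all $\gamma^*_k$-commutators. **Proposition.** Let $G$ be a finite soluble group and let $k\ge 2$ be such that $|ab|=|a||b|$ whenever $a$ and $b$ are $\gamma^*_k$-commutators of $G$ with $\gcd(|a|,|b|)=1$. Then $\gamma^*_k(G)$ is nilpotent. Moreover, $G$ is metanilpotent, that is, $G$ has a nilpotent normal subgroup $N$ with $G/N$ nilpotent; equivalently, the Fitting height of $G$ is at most $2$. Here the Fitting height is the least $t\ge 0$ with $F_t(G)=G$, where $F_0(G)=1$ and $F_{i+1}(G)/F_i(G)$ is the Fitting subgroup of $G/F_i(G)$, the subgroup generated by its nilpotent normal subgroups. -/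

import Mathlib

/-- `IsGammaStarCommutator k g`: the element `g` is a `γ*_k`-commutator (`k ≥ 1`). Every element is
a `γ*_1`-commutator; for `k ≥ 2` the `γ*_k`-commutators are the elements `[a, b] = a⁻¹ b⁻¹ a b`,
where `a` is a power of a `γ*_{k-1}`-commutator, `b` is arbitrary, and `a`, `b` have coprime orders.
The index `0` is not used; it gets the value of the index `1`. -/
def IsGammaStarCommutator {G : Type*} [Group G] : ℕ → G → Prop
  | 0, _ => True
  | 1, _ => True
  | k + 2, g => ∃ x a b : G, IsGammaStarCommutator (k + 1) x ∧ a ∈ Subgroup.zpowers x ∧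
      (orderOf a).Coprime (orderOf b) ∧ g = a⁻¹ * b⁻¹ * a * b

/-- The subgroup `γ*_k(G)` generated by all `γ*_k`-commutators of `G`. -/
def gammaStar (G : Type*) [Group G] (k : ℕ) : Subgroup G :=
  Subgroup.closure {g : G | IsGammaStarCommutator k g}

/-- A group is metanilpotent if it is an extension of a nilpotent group by a nilpotent group. -/
def IsMetanilpotent (G : Type*) [Group G] : Prop :=
  ∃ (N : Subgroup G) (_ : N.Normal), Group.IsNilpotent N ∧ Group.IsNilpotent (G ⧸ N)

/-- The Fitting subgroup `F(G)`, generated by all nilpotent normal subgroups of `G`. -/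
def fittingSubgroup (G : Type*) [Group G] : Subgroup G :=
  sSup {N : Subgroup G | N.Normal ∧ Group.IsNilpotent N}

theorem fittingSubgroup_normal (G : Type*) [Group G] : (fittingSubgroup G).Normal :=
  Subgroup.sSup_normal _ fun _ hN => hN.1

/-- The upper Fitting series, together with the normality of its terms: `F_0(G) = 1`, and
`F_{i+1}(G)` is the full preimage in `G` of `F(G / F_i(G))`. -/
def upperFittingSeriesAux (G : Type*) [Group G] : ℕ → {H : Subgroup G // H.Normal}
  | 0 => ⟨⊥, inferInstance⟩
  | i + 1 =>
    let H := upperFittingSeriesAux G i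
    haveI : H.1.Normal := H.2
    haveI : (fittingSubgroup (G ⧸ H.1)).Normal := fittingSubgroup_normal _
    ⟨(fittingSubgroup (G ⧸ H.1)).comap (QuotientGroup.mk' H.1), inferInstance⟩

/-- The term `F_i(G)` of the upper Fitting series of `G`. -/
def upperFittingSeries (G : Type*) [Group G] (i : ℕ) : Subgroup G :=
  (upperFittingSeriesAux G i).1

/-- The Fitting height: the least `t` with `F_t(G) = G` (it is `⊤` if there is no such `t`). -/
noncomputable def fittingHeight (G : Type*) [Group G] : ℕ∞ :=
  ⨅ (t : ℕ) (_ : upperFittingSeries G t = ⊤), (t : ℕ∞)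

/-! Let `b` be a `q'`-element normalizing a `q`-subgroup `Q`. For `a ∈ Q`, long Engel commutators `x
= [a, b, …, b]` are `γ*_k`-commutators. If `x` normalizes an `r`-subgroup `W`, `r ≠ q`, then so are
the `u = [w, x⁻¹, …, x⁻¹]` with `w ∈ W`. As `u x` is conjugate to `x`, the order hypothesis forces
`u = 1`, and coprime action makes `x` centralize `w`.

This Engel condition passes to quotients. Let `V` be a minimal normal subgroup, a `p`-group, and `C`
its centralizer. In `G/C`, coprime actions on `q`-subgroups with `q ≠ p` are trivial, so `G/C` is
`p`-by-nilpotent; since normal `p`-subgroups of `G/C` are trivial, it is nilpotent. Induction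
through `G/V` gives metanilpotency. Commutators of elements of coprime order die in nilpotent
quotients, so `γ*_k(G)` lies in a nilpotent normal subgroup. -/

/-- The commutator `[a, b] = a⁻¹ b⁻¹ a b`, as a map in `a`; its iterates are the Engel commutators
`[a, b, …, b]`. -/
def commRight {G : Type*} [Group G] (b a : G) : G := a⁻¹ * b⁻¹ * a * b

/-! ### Engel commutators and coprime action -/

section CommRight

variable {G H : Type*} [Group G] [Group H]

theorem commRight_eq_one_iff {a b : G} : commRight b a = 1 ↔ Commute a b := by
  rw [commRight, Commute, SemiconjBy, ← mul_right_inj (b * a)]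
  simp [mul_assoc]

theorem map_commRight_iterate (f : G →* H) (m : ℕ) (a b : G) :
    f ((commRight b)^[m] a) = (commRight (f b))^[m] (f a) := by
  have : Function.Semiconj f (commRight b) (commRight (f b)) := fun x => by simp [commRight]
  exact this.iterate_right m a

theorem commRight_mem {K : Subgroup G} {a b : G} (hb : b ∈ Subgroup.normalizer (K : Set G))
    (ha : a ∈ K) : commRight b a ∈ K := by
  have h : b⁻¹ * a * b ∈ K := (Subgroup.mem_normalizer_iff''.1 hb a).1 ha
  simpa [commRight, mul_assoc] using K.mul_mem (K.inv_mem ha) h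

theorem commRight_iterate_mem {K : Subgroup G} {a b : G}
    (hb : b ∈ Subgroup.normalizer (K : Set G)) (ha : a ∈ K) (m : ℕ) :
    (commRight b)^[m] a ∈ K := by
  induction m with
  | zero => exact ha
  | succ m ih => rw [Function.iterate_succ_apply']; exact commRight_mem hb ih

/-- If `[a, b]` commutes with `b`, the order of `[a, b] b⁻¹` is the product of the two orders; but
this element is a conjugate of `b⁻¹`. -/
theorem commRight_eq_one_of_commRight_commRight [Finite G] {a b : G}
    (hco : (orderOf (commRight b a)).Coprime (orderOf b))
    (h : commRight b (commRight b a) = 1) : commRight b a = 1 := by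
  have hc : Commute (commRight b a) b⁻¹ := (commRight_eq_one_iff.1 h).inv_right
  have h1 := hc.orderOf_mul_eq_mul_orderOf_of_coprime (by rwa [orderOf_inv])
  have h2 : commRight b a * b⁻¹ = MulAut.conj a⁻¹ b⁻¹ := by simp [commRight]
  rw [h2, MulEquiv.orderOf_eq] at h1
  rw [← orderOf_eq_one_iff]
  exact Nat.eq_of_mul_eq_mul_right (orderOf_pos b⁻¹) (by rw [← h1, one_mul])

theorem commute_of_commRight_iterate_eq_one [Finite G] {K : Subgroup G} {a b : G}
    (hb : b ∈ Subgroup.normalizer (K : Set G))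
    (hco : ∀ x ∈ K, (orderOf x).Coprime (orderOf b)) (ha : a ∈ K) (m : ℕ)
    (h : (commRight b)^[m + 1] a = 1) : Commute a b := by
  induction m with
  | zero => exact commRight_eq_one_iff.1 h
  | succ m ih =>
    rw [Function.iterate_succ_apply', Function.iterate_succ_apply'] at h
    apply ih
    rw [Function.iterate_succ_apply']
    exact commRight_eq_one_of_commRight_commRight
      (hco _ (commRight_mem hb (commRight_iterate_mem hb ha m))) h

theorem isGammaStarCommutator_commRight_iterate {K : Subgroup G} {a b : G}
    (hb : b ∈ Subgroup.normalizer (K : Set G))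
    (hco : ∀ x ∈ K, (orderOf x).Coprime (orderOf b)) (ha : a ∈ K) (m : ℕ) :
    IsGammaStarCommutator (m + 1) ((commRight b)^[m] a) := by
  induction m with
  | zero => trivial
  | succ m ih =>
    rw [Function.iterate_succ_apply']
    exact ⟨_, _, b, ih, Subgroup.mem_zpowers _, hco _ (commRight_iterate_mem hb ha m), rfl⟩

end CommRight

/-! ### From the order hypothesis to the Engel condition -/

theorem IsPGroup.coprime_orderOf {G : Type*} [Group G] {p n : ℕ} {K : Subgroup G}
    (hK : IsPGroup p K) (hn : n.Coprime p) {x : G} (hx : x ∈ K) : (orderOf x).Coprime n := by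
  have := hK.orderOf_coprime hn.symm ⟨x, hx⟩
  rwa [Subgroup.orderOf_mk] at this

/-- Engel commutators that lie in a `q`-subgroup `Q` and arise from the action on `Q` of an
element of order prime to `q` centralize all `r`-subgroups normalized by these data, for primes `r ≠ q`. -/
def CoprimeEngelCentralizes (m : ℕ) (G : Type*) [Group G] : Prop :=
  ∀ q r : ℕ, q.Prime → r.Prime → q ≠ r → ∀ W Q : Subgroup G, IsPGroup r W → IsPGroup q Q →
    Q ≤ Subgroup.normalizer (W : Set G) → ∀ b ∈ Subgroup.normalizer (W : Set G),
    b ∈ Subgroup.normalizer (Q : Set G) → (orderOf b).Coprime q → ∀ a ∈ Q, ∀ w ∈ W,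
    Commute ((commRight b)^[m] a) w

theorem coprimeEngelCentralizes_of_orderOf_mul {G : Type*} [Group G] [Finite G] (m : ℕ)
    (h : ∀ a b : G, IsGammaStarCommutator (m + 2) a → IsGammaStarCommutator (m + 2) b →
      (orderOf a).Coprime (orderOf b) → orderOf (a * b) = orderOf a * orderOf b) :
    CoprimeEngelCentralizes (m + 1) G := by
  intro q r hq hr hqr W Q hW hQ hQW b hbW hbQ hb a ha w hw
  set x := (commRight b)^[m + 1] a with hx
  have hxQ : x ∈ Q := commRight_iterate_mem hbQ ha _
  have hxγ : IsGammaStarCommutator (m + 2) x :=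
    isGammaStarCommutator_commRight_iterate hbQ (fun y hy => hQ.coprime_orderOf hb hy) ha _
  have hxr : (orderOf x).Coprime r :=
    hQ.coprime_orderOf ((Nat.coprime_primes hr hq).2 hqr.symm) hxQ
  have hxW : x⁻¹ ∈ Subgroup.normalizer (W : Set G) := inv_mem (hQW hxQ)
  have hco : ∀ y ∈ W, (orderOf y).Coprime (orderOf x⁻¹) := fun y hy =>
    hW.coprime_orderOf (by rwa [orderOf_inv]) hy
  have huγ := isGammaStarCommutator_commRight_iterate hxW hco hw (m + 1)
  have hu := hco _ (commRight_iterate_mem hxW hw (m + 1))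
  have hmul := h _ _ huγ hxγ (by rwa [orderOf_inv] at hu)
  -- With `v` the previous iterate, `[v, x⁻¹] x = v⁻¹ x v`.
  have h2 : (commRight x⁻¹)^[m + 1] w * x = MulAut.conj ((commRight x⁻¹)^[m] w)⁻¹ x := by
    rw [Function.iterate_succ_apply']; simp [commRight]
  rw [h2, MulEquiv.orderOf_eq] at hmul
  have h1 : (commRight x⁻¹)^[m + 1] w = 1 := by
    rw [← orderOf_eq_one_iff]
    exact Nat.eq_of_mul_eq_mul_right (orderOf_pos x) (by rw [← hmul, one_mul])
  have := commute_of_commRight_iterate_eq_one hxW hco hw m h1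
  simpa using this.symm.inv_left

/-! ### Lifting to preimages -/

theorem exists_mem_zpowers_map_eq_of_coprime {G H : Type*} [Group G] [Finite G] [Group H]
    (f : G →* H) {q : ℕ} (hq : q.Prime) {g : G} (hg : (orderOf (f g)).Coprime q) :
    ∃ g' ∈ Subgroup.zpowers g, f g' = f g ∧ (orderOf g').Coprime q := by
  obtain ⟨e, n, hn, he⟩ := Nat.exists_eq_pow_mul_and_not_dvd (orderOf_pos g).ne' q hq.ne_one
  have hcop : (orderOf (f g)).Coprime (q ^ e) := hg.pow_right e
  obtain ⟨j, hj⟩ := exists_pow_eq_self_of_coprime (x := f g) (n := q ^ e) hcop.symm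
  -- Raising to `q ^ e` removes the `q`-part of `g`; `j` inverts `q ^ e` modulo the order of `f g`.
  refine ⟨(g ^ q ^ e) ^ j, Subgroup.pow_mem _ (Subgroup.npow_mem_zpowers _ _) _, by simpa using hj,
    ?_⟩
  have hdvd : orderOf ((g ^ q ^ e) ^ j) ∣ n := by
    apply orderOf_dvd_of_pow_eq_one
    rw [← pow_mul, mul_comm j, pow_mul, ← pow_mul g, ← he, pow_orderOf_eq_one, one_pow]
  exact Nat.Coprime.coprime_dvd_left hdvd ((Nat.Prime.coprime_iff_not_dvd hq).2 hn).symm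

/-- A Frattini argument: `q`-subgroups lift along homomorphisms together with their normalizers. -/
theorem exists_lift_isPGroup_normalizer {G H : Type*} [Group G] [Finite G] [Group H] (f : G →* H)
    {q : ℕ} [Fact q.Prime] (N : Subgroup G) {Q : Subgroup H} (hQ : IsPGroup q Q)
    (hle : Q ≤ N.map f) :
    ∃ R ≤ N, IsPGroup q R ∧ R.map f = Q ∧ ∀ g ∈ N, f g ∈ Subgroup.normalizer (Q : Set H) →
      ∃ g' ∈ N, g' ∈ Subgroup.normalizer (R : Set G) ∧ f g' = f g := by
  set L : Subgroup G := N ⊓ Q.comap f with hL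
  have hLQ : L.map f = Q := by
    apply le_antisymm
    · rintro _ ⟨x, hx, rfl⟩; exact hx.2
    · intro y hy
      obtain ⟨x, hx, rfl⟩ := hle hy
      exact ⟨x, ⟨hx, hy⟩, rfl⟩
  obtain ⟨S⟩ : Nonempty (Sylow q L) := inferInstance
  have hS : (S : Subgroup L).map (f.subgroupMap L) = ⊤ := by
    have h1 : IsPGroup q (⊤ : Subgroup (L.map f)) := (hLQ ▸ hQ : IsPGroup q (L.map f)).to_subgroup ⊤
    exact ((S.mapSurjective (f.subgroupMap_surjective L)).3 h1 le_top).symm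
  set R : Subgroup G := (S : Subgroup L).map L.subtype with hR
  have hRL : R ≤ L := Subgroup.map_subtype_le _
  have hRQ : R.map f = Q := by
    apply le_antisymm
    · exact (Subgroup.map_mono hRL).trans hLQ.le
    · intro y hy
      have : (⟨y, hLQ.symm ▸ hy⟩ : L.map f) ∈ (S : Subgroup L).map (f.subgroupMap L) := by
        rw [hS]; trivial
      obtain ⟨s, hs, hsy⟩ := this
      exact ⟨s, ⟨s, hs, rfl⟩, congrArg Subtype.val hsy⟩
  refine ⟨R, hRL.trans inf_le_left, S.2.map _, hRQ, fun g hg hgQ => ?_⟩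
  have hgL : ∀ x ∈ L, g * x * g⁻¹ ∈ L := fun x hx =>
    ⟨N.mul_mem (N.mul_mem hg hx.1) (N.inv_mem hg), by
      simpa using (Subgroup.mem_normalizer_iff.1 hgQ (f x)).1 hx.2⟩
  have hT : IsPGroup q ((R.map (MulAut.conj g).toMonoidHom).subgroupOf L) :=
    ((S.2.map _).map _).comap_subtype
  -- The conjugate of `R` by `g` is again a `q`-subgroup of `L`; Sylow conjugacy in `L` corrects `g`
  -- to normalize `R`.
  obtain ⟨T, hT⟩ := hT.exists_le_sylow
  obtain ⟨n, rfl⟩ := MulAction.exists_smul_eq L S T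
  have hn : f n ∈ Q := n.2.2
  have hmem : (n : G)⁻¹ * g ∈ Subgroup.normalizer (R : Set G) := by
    refine Subgroup.mem_normalizer_fintype fun x hx => ?_
    have hx' : (⟨g * x * g⁻¹, hgL x (hRL hx)⟩ : L) ∈ n • S :=
      hT (Subgroup.mem_subgroupOf.2 ⟨x, hx, by simp⟩)
    have hx'' : (MulAut.conj n)⁻¹ • (⟨g * x * g⁻¹, hgL x (hRL hx)⟩ : L) ∈ (S : Subgroup L) :=
      Subgroup.mem_pointwise_smul_iff_inv_smul_mem.1 hx'
    refine ⟨_, hx'', ?_⟩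
    simp [← map_inv, mul_assoc]
  obtain ⟨s, hs, hsn⟩ : f n ∈ R.map f := hRQ.symm ▸ hn
  exact ⟨s * (n⁻¹ * g), N.mul_mem (hRL hs).1 (N.mul_mem (N.inv_mem n.2.1) hg),
    mul_mem (Subgroup.le_normalizer hs) hmem, by simp [hsn]⟩

/-- The lifts are nested: `W` first, then `Q` and `b` inside the normalizer of the lift of `W`. -/
theorem CoprimeEngelCentralizes.of_surjective {G H : Type*} [Group G] [Finite G] [Group H] {m : ℕ}
    (hG : CoprimeEngelCentralizes m G) (f : G →* H) (hf : Function.Surjective f) :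
    CoprimeEngelCentralizes m H := by
  intro q r hq hr hqr W Q hW hQ hQW b hbW hbQ hb a ha w hw
  have := Fact.mk hq
  have := Fact.mk hr
  obtain ⟨W', -, hW', rfl, hNW⟩ := exists_lift_isPGroup_normalizer f ⊤ hW
    (by rw [Subgroup.map_top_of_surjective f hf]; exact le_top)
  have hle : ∀ x ∈ Subgroup.normalizer ((W'.map f : Subgroup H) : Set H),
      ∃ g ∈ Subgroup.normalizer (W' : Set G), f g = x := by
    intro x hx
    obtain ⟨g, rfl⟩ := hf x
    obtain ⟨g', -, h1, h2⟩ := hNW g trivial hx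
    exact ⟨g', h1, h2⟩
  obtain ⟨Q', hQ'W, hQ', rfl, hNQ⟩ :=
    exists_lift_isPGroup_normalizer f (Subgroup.normalizer (W' : Set G)) hQ
      (fun x hx => hle x (hQW hx))
  obtain ⟨g, hgW, rfl⟩ := hle b hbW
  obtain ⟨g', hg'W, hg'Q, hgg'⟩ := hNQ g hgW hbQ
  rw [← hgg'] at hb ⊢
  obtain ⟨c, hc, hcg, hcq⟩ := exists_mem_zpowers_map_eq_of_coprime f hq hb
  rw [← hcg]
  obtain ⟨a, ha, rfl⟩ := ha
  obtain ⟨w, hw, rfl⟩ := hw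
  rw [← map_commRight_iterate]
  exact (hG q r hq hr hqr W' Q' hW' hQ' hQ'W c ((Subgroup.zpowers_le.2 hg'W) hc)
    ((Subgroup.zpowers_le.2 hg'Q) hc) hcq a ha w hw).map f

/-! ### Trivial coprime actions -/

/-- For primes `q ≠ p`, elements of order prime to `q` centralize all `q`-subgroups
that they normalize. -/
def CoprimeActionTrivial (p : ℕ) (G : Type*) [Group G] : Prop :=
  ∀ q : ℕ, q.Prime → q ≠ p → ∀ Q : Subgroup G, IsPGroup q Q →
    ∀ b ∈ Subgroup.normalizer (Q : Set G), (orderOf b).Coprime q → ∀ a ∈ Q, Commute a b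

theorem CoprimeActionTrivial.of_surjective {G H : Type*} [Group G] [Finite G] [Group H] {p : ℕ}
    (hG : CoprimeActionTrivial p G) (f : G →* H) (hf : Function.Surjective f) :
    CoprimeActionTrivial p H := by
  intro q hq hqp Q hQ b hbQ hb a ha
  have := Fact.mk hq
  obtain ⟨Q', -, hQ', rfl, hNQ⟩ := exists_lift_isPGroup_normalizer f ⊤ hQ
    (by rw [Subgroup.map_top_of_surjective f hf]; exact le_top)
  obtain ⟨g, rfl⟩ := hf b
  obtain ⟨g', -, hg'Q, hgg'⟩ := hNQ g trivial hbQ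
  rw [← hgg'] at hb ⊢
  obtain ⟨c, hc, hcg, hcq⟩ := exists_mem_zpowers_map_eq_of_coprime f hq hb
  rw [← hcg]
  obtain ⟨a, ha, rfl⟩ := ha
  exact (hG q hq hqp Q' hQ' c ((Subgroup.zpowers_le.2 hg'Q) hc) hcq a ha).map f

/-- The quotient by the centralizer of a normal `p`-subgroup `V` inherits trivial coprime actions
from the Engel condition. -/
theorem CoprimeEngelCentralizes.coprimeActionTrivial {G : Type*} [Group G] [Finite G] {m p : ℕ}
    (hG : CoprimeEngelCentralizes (m + 1) G) (hp : p.Prime) (V : Subgroup G) [V.Normal]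
    (hV : IsPGroup p V) : CoprimeActionTrivial p (G ⧸ Subgroup.centralizer (V : Set G)) := by
  intro q hq hqp Q hQ b hbQ hb a ha
  have := Fact.mk hq
  set f := QuotientGroup.mk' (Subgroup.centralizer (V : Set G))
  have hf : Function.Surjective f := QuotientGroup.mk'_surjective _
  obtain ⟨Q', -, hQ', rfl, hNQ⟩ := exists_lift_isPGroup_normalizer f ⊤ hQ
    (by rw [Subgroup.map_top_of_surjective f hf]; exact le_top)
  obtain ⟨g, rfl⟩ := hf b
  obtain ⟨g', -, hg'Q, hgg'⟩ := hNQ g trivial hbQ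
  rw [← hgg'] at hb ⊢
  obtain ⟨c, hc, hcg, hcq⟩ := exists_mem_zpowers_map_eq_of_coprime f hq hb
  replace hc := (Subgroup.zpowers_le.2 hg'Q) hc
  rw [← hcg] at hb ⊢
  obtain ⟨a, ha, rfl⟩ := ha
  have hVtop : Subgroup.normalizer (V : Set G) = ⊤ := Subgroup.normalizer_eq_top _
  have key : f ((commRight c)^[m + 1] a) = 1 := by
    refine (QuotientGroup.eq_one_iff _).2 (Subgroup.mem_centralizer_iff.2 fun w hw => ?_)
    exact (hG q p hq hp hqp V Q' hV hQ' (hVtop ▸ le_top) c (hVtop ▸ trivial) hc hcq a ha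
      w hw).eq.symm
  rw [map_commRight_iterate] at key
  have hc' : f c ∈ Subgroup.normalizer ((Q'.map f : Subgroup _) : Set _) := by
    rw [hcg, hgg']; exact hbQ
  exact commute_of_commRight_iterate_eq_one hc' (fun x hx => hQ.coprime_orderOf hb hx)
    ⟨a, ha, rfl⟩ m key

/-! ### Minimal normal subgroups -/

/-- A minimal normal subgroup of `G`. -/
structure IsMinimalNormal {G : Type*} [Group G] (V : Subgroup G) : Prop where
  ne_bot : V ≠ ⊥
  eq_of_le : ∀ U : Subgroup G, U.Normal → U ≤ V → U ≠ ⊥ → U = V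

theorem exists_isMinimalNormal (G : Type*) [Group G] [Finite G] [Group.IsSolvable G]
    [Nontrivial G] :
    ∃ V : Subgroup G, V.Normal ∧ IsMinimalNormal V ∧ ∃ p : ℕ, p.Prime ∧ IsPGroup p V := by
  obtain ⟨V, hV⟩ := (Set.toFinite {U : Subgroup G | U.Normal ∧ U ≠ ⊥}).exists_minimal
    ⟨⊤, inferInstance, bot_ne_top.symm⟩
  have hVn : V.Normal := hV.prop.1
  have hVb : V ≠ ⊥ := hV.prop.2
  have hmin : ∀ U : Subgroup G, U.Normal → U ≤ V → U ≠ ⊥ → U = V := fun U h1 h2 h3 =>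
    le_antisymm h2 (hV.le_of_le ⟨h1, h3⟩ h2)
  have hcomm : ⁅V, V⁆ = ⊥ := by
    by_contra hne
    have hlt := Group.IsSolvable.commutator_lt_of_ne_bot hVb
    exact hlt.ne (hmin _ inferInstance hlt.le hne)
  have hc : ∀ x ∈ V, ∀ y ∈ V, Commute x y := fun x hx y hy =>
    (Subgroup.mem_centralizer_iff.1 (Subgroup.commutator_eq_bot_iff_le_centralizer.1 hcomm hy) x hx)
  have := (Subgroup.nontrivial_iff_ne_bot V).2 hVb
  obtain ⟨p, hp, hpV⟩ := Nat.exists_prime_and_dvd (Finite.one_lt_card (α := V)).ne'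
  have := Fact.mk hp
  obtain ⟨x, hx⟩ := exists_prime_orderOf_dvd_card' p hpV
  let U : Subgroup G :=
    { carrier := {x | x ∈ V ∧ x ^ p = 1}
      mul_mem' := fun {a b} ha hb => ⟨V.mul_mem ha.1 hb.1, by
        rw [(hc a ha.1 b hb.1).mul_pow, ha.2, hb.2, one_mul]⟩
      one_mem' := ⟨V.one_mem, one_pow p⟩
      inv_mem' := fun {a} ha => ⟨V.inv_mem ha.1, by rw [inv_pow, ha.2, inv_one]⟩ }
  -- The elements of `V` killed by `p` form a nontrivial normal subgroup of `G`.
  have hU : U = V := by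
    refine hmin U ⟨fun a ha g => ⟨hVn.conj_mem a ha.1 g, ?_⟩⟩ (fun a ha => ha.1) fun hbot => ?_
    · rw [conj_pow, ha.2, mul_one, mul_inv_cancel]
    · have hxU : (x : G) ∈ U := ⟨x.2, by rw [← Subgroup.coe_pow, ← hx, pow_orderOf_eq_one]; rfl⟩
      rw [hbot, Subgroup.mem_bot, OneMemClass.coe_eq_one] at hxU
      rw [hxU, orderOf_one] at hx
      exact hp.ne_one hx.symm
  refine ⟨V, hVn, ⟨hVb, hmin⟩, p, hp, fun y => ⟨1, ?_⟩⟩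
  have hy : (y : G) ∈ U := by rw [hU]; exact y.2
  exact Subtype.ext (by simpa using hy.2)

/-- A `p`-group acting on a nontrivial `p`-group has a nontrivial fixed point, and the fixed points
of `P` in `V` are normal in `G`. -/
theorem IsMinimalNormal.le_centralizer {G : Type*} [Group G] [Finite G] {V : Subgroup G}
    [V.Normal] (hV : IsMinimalNormal V) {p : ℕ} (hp : p.Prime) (hVp : IsPGroup p V)
    (P : Subgroup G) [P.Normal]
    (hP : ∀ g ∈ P, ∃ n : ℕ, g ^ p ^ n ∈ Subgroup.centralizer (V : Set G)) :
    P ≤ Subgroup.centralizer (V : Set G) := by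
  have := Fact.mk hp
  set φ : G →* MulAut V := MulAut.conjNormal
  have hA : IsPGroup p (P.map φ) := by
    rintro ⟨_, g, hg, rfl⟩
    obtain ⟨n, hn⟩ := hP g hg
    refine ⟨n, Subtype.ext ?_⟩
    change φ g ^ p ^ n = 1
    rw [← map_pow]
    ext v
    rw [MulAut.conjNormal_apply, ← Subgroup.mem_centralizer_iff.1 hn v v.2, mul_inv_cancel_right]
    rfl
  have := (Subgroup.nontrivial_iff_ne_bot V).2 hV.ne_bot
  have hpV : p ∣ Nat.card V :=
    hVp.card_eq_or_dvd.resolve_left (Finite.one_lt_card (α := V)).ne'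
  obtain ⟨v, hv, hv1⟩ := hA.exists_fixed_point_of_prime_dvd_card_of_fixed_point V hpV (a := 1)
    (fun g => map_one (g : MulAut V))
  have hU : V ⊓ Subgroup.centralizer (P : Set G) = V := by
    refine hV.eq_of_le _ inferInstance inf_le_left fun hbot => hv1 ?_
    have hmem : (v : G) ∈ V ⊓ Subgroup.centralizer (P : Set G) := by
      refine ⟨v.2, Subgroup.mem_centralizer_iff.2 fun g hg => ?_⟩
      have h1 : φ g v = v := hv ⟨φ g, g, hg, rfl⟩
      have h2 := congrArg Subtype.val h1
      rw [MulAut.conjNormal_apply] at h2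
      exact mul_inv_eq_iff_eq_mul.1 h2
    rw [hbot, Subgroup.mem_bot] at hmem
    exact Subtype.ext hmem.symm
  exact Subgroup.le_centralizer_iff.1 (inf_eq_left.1 hU)

/-! ### Nilpotent quotients and metanilpotency -/

theorem isNilpotent_quotient_of_ker_le {G H : Type*} [Group G] [Group H] [Group.IsNilpotent H]
    (f : G →* H) (K : Subgroup G) [K.Normal] (h : f.ker ≤ K) : Group.IsNilpotent (G ⧸ K) := by
  have : Group.IsNilpotent (G ⧸ f.ker) :=
    Group.nilpotent_of_mulEquiv (QuotientGroup.quotientKerEquivRange f).symm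
  exact Group.nilpotent_of_surjective (QuotientGroup.map f.ker K (MonoidHom.id G) h)
    (QuotientGroup.map_surjective_of_surjective _ _ _
      (by exact QuotientGroup.mk'_surjective K) _)

theorem CoprimeActionTrivial.exists_isPGroup_isNilpotent_quotient {p : ℕ} (hp : p.Prime)
    (G : Type*) [Group G] [Finite G] [Group.IsSolvable G] (hG : CoprimeActionTrivial p G) :
    ∃ (P : Subgroup G) (_ : P.Normal), IsPGroup p P ∧ Group.IsNilpotent (G ⧸ P) := by
  induction hn : Nat.card G using Nat.strong_induction_on generalizing G with
  | _ n ih =>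
  subst hn
  have := Fact.mk hp
  rcases subsingleton_or_nontrivial G with hsub | hnt
  · exact ⟨⊥, inferInstance, .of_bot, inferInstance⟩
  obtain ⟨V, hVn, hV, r, hr, hVr⟩ := exists_isMinimalNormal G
  have := Fact.mk hr
  have hlt : Nat.card (G ⧸ V) < Nat.card G := by
    have := (Subgroup.nontrivial_iff_ne_bot V).2 hV.ne_bot
    rw [Subgroup.card_eq_card_quotient_mul_card_subgroup V]
    exact lt_mul_of_one_lt_right Nat.card_pos Finite.one_lt_card
  obtain ⟨P, hPn, hP, hPnil⟩ := ih _ hlt (G ⧸ V)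
    (hG.of_surjective (QuotientGroup.mk' V) (QuotientGroup.mk'_surjective V)) rfl
  set Y : Subgroup G := P.comap (QuotientGroup.mk' V) with hY
  set f : G →* (G ⧸ V) ⧸ P := (QuotientGroup.mk' P).comp (QuotientGroup.mk' V) with hf
  have hker : f.ker = Y := by
    ext x
    simp [hf, hY, MonoidHom.mem_ker]
  rcases eq_or_ne r p with rfl | hrp
  · exact ⟨Y, inferInstance,
      hP.comap_of_ker_isPGroup _ (by rwa [QuotientGroup.ker_mk']),
      isNilpotent_quotient_of_ker_le f Y hker.le⟩
  have hcent : ∀ v ∈ V, ∀ g : G, Commute v g := by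
    -- The `r'`-part of every element centralizes `V`, so `G` acts on `V` as an `r`-group.
    have htop := hV.le_centralizer hr hVr ⊤ fun g _ => by
      obtain ⟨e, n, hn, he⟩ := Nat.exists_eq_pow_mul_and_not_dvd (orderOf_pos g).ne' r hr.ne_one
      refine ⟨e, Subgroup.mem_centralizer_iff.2 fun v hv => ?_⟩
      refine hG r hr hrp V hVr _ (by rw [Subgroup.normalizer_eq_top]; trivial) ?_ v hv
      rw [orderOf_pow_of_dvd (pow_ne_zero _ hr.ne_zero) (he ▸ dvd_mul_right _ _), he,
        Nat.mul_div_cancel_left _ (pow_pos hr.pos _)]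
      exact ((Nat.Prime.coprime_iff_not_dvd hr).2 hn).symm
    exact fun v hv g => Subgroup.mem_centralizer_iff.1 (htop trivial) v hv
  have hYnil : Group.IsNilpotent Y := by
    have : Group.IsNilpotent P := hP.isNilpotent
    refine Subgroup.isNilpotent_of_ker_le_center ((QuotientGroup.mk' V).subgroupComap P) ?_
    intro y hy
    have hyV : (y : G) ∈ V := (QuotientGroup.eq_one_iff _).1 (congrArg Subtype.val hy)
    exact Subgroup.mem_center_iff.2 fun g => Subtype.ext (hcent y hyV g).eq.symm
  obtain ⟨S⟩ : Nonempty (Sylow p Y) := inferInstance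
  have hSn : (S : Subgroup Y).Normal := inferInstance
  have hSc : (S : Subgroup Y).Characteristic := S.characteristic_of_normal hSn
  set R : Subgroup G := (S : Subgroup Y).map Y.subtype with hR
  have hRY : R ≤ f.ker := hker ▸ Subgroup.map_subtype_le _
  refine ⟨R, inferInstance, S.2.map _, ?_⟩
  -- `Y/R` is central: its elements have order prime to `p`, hence are powers of their `p ^ j`-th
  -- powers, which come from the central subgroup `V`.
  refine Subgroup.isNilpotent_of_ker_le_center (QuotientGroup.lift R f hRY) ?_
  intro z hz
  obtain ⟨y, rfl⟩ := QuotientGroup.mk_surjective z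
  have hyY : y ∈ Y := hker ▸ hz
  obtain ⟨j, hj⟩ := hP ⟨_, hyY⟩
  have hyV : y ^ p ^ j ∈ V := (QuotientGroup.eq_one_iff _).1 (by simpa using congrArg Subtype.val hj)
  have hidx : (y : G ⧸ R) ^ (S : Subgroup Y).index = 1 := by
    rw [← QuotientGroup.mk_pow, QuotientGroup.eq_one_iff]
    exact ⟨_, Subgroup.pow_index_mem (S : Subgroup Y) ⟨y, hyY⟩, rfl⟩
  have hcop : (p ^ j).Coprime (orderOf (y : G ⧸ R)) :=
    Nat.Coprime.pow_left _ (Nat.Coprime.coprime_dvd_right (orderOf_dvd_of_pow_eq_one hidx)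
      ((Nat.Prime.coprime_iff_not_dvd hp).2 S.not_dvd_index))
  obtain ⟨i, hi⟩ := exists_pow_eq_self_of_coprime hcop
  rw [← hi]
  refine Subgroup.pow_mem _ (Subgroup.mem_center_iff.2 fun g => ?_) _
  obtain ⟨g, rfl⟩ := QuotientGroup.mk_surjective g
  rw [← QuotientGroup.mk_pow, ← QuotientGroup.mk_mul, ← QuotientGroup.mk_mul, (hcent _ hyV g).eq]

theorem CoprimeEngelCentralizes.isMetanilpotent {m : ℕ} (G : Type*) [Group G] [Finite G]
    [Group.IsSolvable G] (hG : CoprimeEngelCentralizes (m + 1) G) : IsMetanilpotent G := by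
  induction hn : Nat.card G using Nat.strong_induction_on generalizing G with
  | _ n ih =>
  subst hn
  rcases subsingleton_or_nontrivial G with hsub | hnt
  · exact ⟨⊥, inferInstance, inferInstance, inferInstance⟩
  obtain ⟨V, hVn, hV, p, hp, hVp⟩ := exists_isMinimalNormal G
  have hlt : Nat.card (G ⧸ V) < Nat.card G := by
    have := (Subgroup.nontrivial_iff_ne_bot V).2 hV.ne_bot
    rw [Subgroup.card_eq_card_quotient_mul_card_subgroup V]
    exact lt_mul_of_one_lt_right Nat.card_pos Finite.one_lt_card
  obtain ⟨M, hMn, hM, hMq⟩ := ih _ hlt (G ⧸ V)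
    (hG.of_surjective (QuotientGroup.mk' V) (QuotientGroup.mk'_surjective V)) rfl
  set C := Subgroup.centralizer (V : Set G) with hC
  have hCnil : Group.IsNilpotent (G ⧸ C) := by
    obtain ⟨P, hPn, hP, hPq⟩ :=
      (hG.coprimeActionTrivial hp V hVp).exists_isPGroup_isNilpotent_quotient hp
    refine isNilpotent_quotient_of_ker_le ((QuotientGroup.mk' P).comp (QuotientGroup.mk' C)) C ?_
    intro g hg
    -- The preimage of `P` acts on `V` as a `p`-group, so it lies in `C`.
    have hle := hV.le_centralizer hp hVp (P.comap (QuotientGroup.mk' C)) fun x hx => by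
      obtain ⟨j, hj⟩ := hP ⟨_, hx⟩
      exact ⟨j, (QuotientGroup.eq_one_iff _).1 (by simpa using congrArg Subtype.val hj)⟩
    have hgP : QuotientGroup.mk' C g ∈ P := (QuotientGroup.eq_one_iff _).1 hg
    exact hle hgP
  -- This subgroup is a central extension of a subgroup of `M`, with kernel inside `V`; its quotient
  -- embeds in `G/C × (G/V)/M`.
  refine ⟨C ⊓ M.comap (QuotientGroup.mk' V), inferInstance, ?_, ?_⟩
  · let φ : (C ⊓ M.comap (QuotientGroup.mk' V) : Subgroup G) →* M :=
      ((QuotientGroup.mk' V).subgroupComap M).comp (Subgroup.inclusion inf_le_right)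
    refine Subgroup.isNilpotent_of_ker_le_center φ ?_
    intro y hy
    have hyV : (y : G) ∈ V := (QuotientGroup.eq_one_iff _).1 (congrArg Subtype.val hy)
    exact Subgroup.mem_center_iff.2 fun g => Subtype.ext
      (Subgroup.mem_centralizer_iff.1 g.2.1 y hyV).symm
  · refine isNilpotent_quotient_of_ker_le ((QuotientGroup.mk' C).prod
      ((QuotientGroup.mk' M).comp (QuotientGroup.mk' V))) _ ?_
    intro g hg
    have h := Prod.ext_iff.1 (MonoidHom.mem_ker.1 hg)
    have hgM : QuotientGroup.mk' V g ∈ M := (QuotientGroup.eq_one_iff _).1 h.2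
    exact ⟨(QuotientGroup.eq_one_iff _).1 h.1, hgM⟩

/-- In each Sylow factor, one of the two components is trivial. -/
theorem commute_of_coprime_orderOf_of_isNilpotent {G : Type*} [Group G] [Finite G]
    [Group.IsNilpotent G] {a b : G} (h : (orderOf a).Coprime (orderOf b)) : Commute a b := by
  obtain ⟨e⟩ := ((Group.isNilpotent_of_finite_tfae (G := G)).out 0 4 rfl rfl).1 ‹_›
  refine Commute.of_map (f := e.symm) e.symm.injective ?_
  funext p P
  have := Fact.mk (Nat.prime_of_mem_primeFactors p.2)
  let π : G →* P := ((Pi.evalMonoidHom _ P).comp (Pi.evalMonoidHom _ p)).comp e.symm.toMonoidHom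
  change Commute (π a) (π b)
  have hco : (orderOf (π a)).Coprime (orderOf (π b)) :=
    (h.coprime_dvd_left (orderOf_map_dvd π a)).coprime_dvd_right (orderOf_map_dvd π b)
  by_cases ha : π a = 1
  · rw [ha]; exact Commute.one_left _
  by_cases hb : π b = 1
  · rw [hb]; exact Commute.one_right _
  exact absurd hco (Nat.not_coprime_of_dvd_of_dvd (Fact.out : (p : ℕ).Prime).one_lt
    (P.2.dvd_orderOf ha) (P.2.dvd_orderOf hb))

theorem gammaStar_le {G : Type*} [Group G] [Finite G] (N : Subgroup G) [N.Normal]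
    [Group.IsNilpotent (G ⧸ N)] (k : ℕ) : gammaStar G (k + 2) ≤ N := by
  rw [gammaStar, Subgroup.closure_le]
  rintro g ⟨x, a, b, -, -, hco, rfl⟩
  have h : Commute (a : G ⧸ N) b := commute_of_coprime_orderOf_of_isNilpotent
    ((hco.coprime_dvd_left (orderOf_map_dvd (QuotientGroup.mk' N) a)).coprime_dvd_right
      (orderOf_map_dvd (QuotientGroup.mk' N) b))
  refine (QuotientGroup.eq_one_iff _).1 ?_
  exact commRight_eq_one_iff.2 h

theorem Group.IsNilpotent.of_injective {G H : Type*} [Group G] [Group H] [Group.IsNilpotent H]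
    (f : G →* H) (hf : Function.Injective f) : Group.IsNilpotent G :=
  Subgroup.isNilpotent_of_ker_le_center f ((f.ker_eq_bot_iff.2 hf).trans_le bot_le)

theorem fittingSubgroup_eq_top (G : Type*) [Group G] [Group.IsNilpotent G] :
    fittingSubgroup G = ⊤ :=
  top_le_iff.1 (le_sSup ⟨inferInstance, inferInstance⟩)

theorem le_upperFittingSeries_one {G : Type*} [Group G] (N : Subgroup G) [hN : N.Normal]
    [Group.IsNilpotent N] : N ≤ upperFittingSeries G 1 := by
  intro x hx
  have hmap : N.map (QuotientGroup.mk' ⊥) ≤ fittingSubgroup (G ⧸ (⊥ : Subgroup G)) :=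
    le_sSup ⟨hN.map _ (QuotientGroup.mk'_surjective _),
      Group.nilpotent_of_surjective _ (MonoidHom.subgroupMap_surjective _ N)⟩
  exact hmap ⟨x, hx, rfl⟩

theorem IsMetanilpotent.fittingHeight_le_two {G : Type*} [Group G] (h : IsMetanilpotent G) :
    fittingHeight G ≤ 2 := by
  obtain ⟨N, hNn, hN, hNq⟩ := h
  refine iInf₂_le_of_le 2 ?_ le_rfl
  have hn : (upperFittingSeriesAux G 1).1.Normal := (upperFittingSeriesAux G 1).2
  have hnil : Group.IsNilpotent (G ⧸ (upperFittingSeriesAux G 1).1) :=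
    isNilpotent_quotient_of_ker_le (QuotientGroup.mk' N) _
      (by rw [QuotientGroup.ker_mk']; exact le_upperFittingSeries_one N)
  change (fittingSubgroup (G ⧸ (upperFittingSeriesAux G 1).1)).comap _ = ⊤
  rw [fittingSubgroup_eq_top, Subgroup.comap_top]

theorem mainTheorem4 (G : Type*) [Group G] [Finite G] [Group.IsSolvable G] (k : ℕ) (hk : 2 ≤ k)
    (h : ∀ a b : G, IsGammaStarCommutator k a → IsGammaStarCommutator k b →
      (orderOf a).Coprime (orderOf b) → orderOf (a * b) = orderOf a * orderOf b) :
    Group.IsNilpotent (gammaStar G k) ∧ IsMetanilpotent G ∧ fittingHeight G ≤ 2 := by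
  obtain ⟨m, rfl⟩ := Nat.exists_eq_add_of_le' hk
  have hmeta := (coprimeEngelCentralizes_of_orderOf_mul m h).isMetanilpotent
  refine ⟨?_, hmeta, hmeta.fittingHeight_le_two⟩
  obtain ⟨N, hNn, hN, hNq⟩ := hmeta
  exact Group.IsNilpotent.of_injective _ (Subgroup.inclusion_injective (gammaStar_le N m))
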